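/- Let $b>a>0$ and $D_{ab}=\{\lambda+i\mu\in\mathbb C : a\le\lambda\le b,\ |\mu|\le a/2\}$. For real $s,\ell,t$ put $\langle x\rangle=\sqrt{1+|x|^2}$, $\langle D\rangle=\sqrt{1-\Delta}$, and $$L^{2,s}=\{f : \langle x\rangle^{s}f\in L^2(\mathbb R^3)\},\qquad H^{\ell,t}=\{f\in\mathcal S'(\mathbb R^3) : \langle x\rangle^{t}\langle D\rangle^{\ell}f\in L^2(\mathbb R^3)\},$$ with norms $\|\langle x\rangle^{s}f\|_{L^2}$ and $\|\langle x\rangle^{t}\langle D\rangle^{\ell}f\|_{L^2}$. Let $\gamma\in C_0^\infty(\mathbb R^3)$ be any function with $\gamma(\xi)=1$ if $\tfrac12a^2\le|\xi|^2\le\tfrac32b^2$, and $\gamma(\xi)=0$ if $|\xi|^2\le\tfrac14a^2$ or $|\xi|^2\ge2b^2$. For $z\in D_{ab}$ let $B(z)$ be the operator $$B(z)=\mathcal F^{-1}\Big[\frac{(1-\gamma(\xi))\,|\xi|}{|\xi|^2-z^2}\Big]\mathcal F$$ on $L^2(\mathbb R^3)$, where $\mathcal F u(\xi)=(2\pi)^{-3/2}\int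 e^{-ix\cdot\xi}u(x)\,dx$ (its symbol is bounded, so $B(z)$ is bounded on $L^2$). If $0\le s<5/2$ and $t<s-3/2$, then for every $z\in D_{ab}$ the operator $B(z)$ maps $L^{2,s}$ (which is contained in $L^2$) boundedly into $H^{1,t}$, and $z\mapsto B(z)$ is continuous from $D_{ab}$ to the Banach space $\mathbf B(L^{2,s},H^{1,t})$ of bounded linear operators with the operator norm. -/

import Mathlib

open MeasureTheory FourierTransform SchwartzMap
open scoped ENNReal ContDiff

noncomputable section

namespace SqrtLaplacian

/-- Three-dimensional Euclidean space. -/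
abbrev R3 : Type := EuclideanSpace ℝ (Fin 3)

/-- The space `L²(ℝ³)` of complex-valued functions, with Lebesgue measure. -/
abbrev L2 : Type := Lp (α := R3) ℂ 2 volume

/-- The Japanese bracket `⟨x⟩ = √(1 + |x|²)`. -/
def bracket (x : R3) : ℝ := Real.sqrt (1 + ‖x‖ ^ 2)

/-- The weight `⟨x⟩ ^ s`, as a complex-valued function. -/
def weight (s : ℝ) (x : R3) : ℂ := ((bracket x ^ s : ℝ) : ℂ)

theorem one_le_bracket (x : R3) : 1 ≤ bracket x := by
  unfold bracket
  rw [Real.one_le_sqrt]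
  nlinarith [sq_nonneg ‖x‖]

theorem weight_eq (s : ℝ) (x : R3) : weight s x = (((1 + ‖x‖ ^ 2) ^ (s / 2) : ℝ) : ℂ) := by
  unfold weight bracket
  rw [Real.sqrt_eq_rpow, ← Real.rpow_mul (by positivity)]
  congr 2
  ring

theorem weight_hasTemperateGrowth (s : ℝ) : (weight s).HasTemperateGrowth := by
  have h : weight s = fun x : R3 => (((1 + ‖x‖ ^ 2) ^ (s / 2) : ℝ) : ℂ) := funext (weight_eq s)
  rw [h]
  fun_prop

theorem weight_ne_zero (s : ℝ) (x : R3) : weight s x ≠ 0 := by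
  unfold weight
  exact_mod_cast (Real.rpow_pos_of_pos (by linarith [one_le_bracket x]) s).ne'

theorem weight_mul_neg (s : ℝ) : weight s * weight (-s) = fun _ => 1 := by
  funext x
  have h : 0 < bracket x := by linarith [one_le_bracket x]
  simp only [Pi.mul_apply, weight]
  rw [← Complex.ofReal_mul, ← Real.rpow_add h]
  simp

theorem one_le_norm_weight {s : ℝ} (hs : 0 ≤ s) (x : R3) : 1 ≤ ‖weight s x‖ := by
  unfold weight
  rw [Complex.norm_real, Real.norm_eq_abs]
  exact (Real.one_le_rpow (one_le_bracket x) hs).trans (le_abs_self _)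

/-! ### The weighted space `L^{2,s}` -/

/-- The classes of measurable functions `f` on `ℝ³` with `⟨x⟩ ^ s f ∈ L²`. -/
def weightedL2Submodule (s : ℝ) : Submodule ℂ (R3 →ₘ[volume] ℂ) where
  carrier := {f | MemLp (fun x => weight s x * f x) 2 volume}
  add_mem' {f g} hf hg := by
    refine (hf.add hg).ae_eq ?_
    filter_upwards [AEEqFun.coeFn_add f g] with x hx
    simp [hx, mul_add]
  zero_mem' := by
    refine (MemLp.zero (ε := ℂ)).ae_eq ?_
    filter_upwards [AEEqFun.coeFn_zero (α := R3) (β := ℂ) (μ := volume)] with x hx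
    simp [hx]
  smul_mem' c f hf := by
    refine (hf.const_smul c).ae_eq ?_
    filter_upwards [AEEqFun.coeFn_smul c f] with x hx
    simp [hx, mul_left_comm]

/-- The weighted space `L^{2,s}(ℝ³) = {f | ⟨x⟩ ^ s f ∈ L²}`. -/
def WeightedL2 (s : ℝ) : Type := ↥(weightedL2Submodule s)

namespace WeightedL2

variable {s : ℝ}

instance : AddCommGroup (WeightedL2 s) := inferInstanceAs (AddCommGroup ↥(weightedL2Submodule s))

instance : Module ℂ (WeightedL2 s) := inferInstanceAs (Module ℂ ↥(weightedL2Submodule s))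

/-- The underlying (class of a) function. -/
def toFun : WeightedL2 s →ₗ[ℂ] (R3 →ₘ[volume] ℂ) := (weightedL2Submodule s).subtype

theorem memLp (f : WeightedL2 s) : MemLp (fun x => weight s x * toFun f x) 2 volume :=
  Subtype.prop (p := fun g => g ∈ weightedL2Submodule s) f

/-- The map `f ↦ ⟨x⟩ ^ s f` from `L^{2,s}` to `L²`. -/
def mulWeight : WeightedL2 s →ₗ[ℂ] L2 where
  toFun f := (memLp f).toLp _
  map_add' f g := by
    rw [← MemLp.toLp_add, MemLp.toLp_eq_toLp_iff, map_add]
    filter_upwards [AEEqFun.coeFn_add (toFun f) (toFun g)] with x hx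
    simp [hx, mul_add]
  map_smul' c f := by
    rw [RingHom.id_apply, ← MemLp.toLp_const_smul, MemLp.toLp_eq_toLp_iff, map_smul]
    filter_upwards [AEEqFun.coeFn_smul c (toFun f)] with x hx
    simp [hx, mul_left_comm]

theorem mulWeight_injective : Function.Injective (mulWeight (s := s)) := by
  intro f g h
  have h' := (MemLp.toLp_eq_toLp_iff (memLp f) (memLp g)).1 h
  refine Subtype.ext (AEEqFun.ext ?_)
  filter_upwards [h'] with x hx
  exact mul_left_cancel₀ (weight_ne_zero s x) hx

/-- The norm of `L^{2,s}` is `‖f‖ = ‖⟨x⟩ ^ s f‖_{L²}`. -/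
instance : NormedAddCommGroup (WeightedL2 s) :=
  NormedAddCommGroup.induced (WeightedL2 s) L2 mulWeight mulWeight_injective

instance : NormedSpace ℂ (WeightedL2 s) := NormedSpace.induced ℂ (WeightedL2 s) L2 mulWeight

theorem norm_def (f : WeightedL2 s) : ‖f‖ = ‖mulWeight f‖ := rfl

theorem memLp_of_nonneg (hs : 0 ≤ s) (f : WeightedL2 s) : MemLp (toFun f) 2 volume := by
  refine (memLp f).mono (toFun f).aestronglyMeasurable (Filter.Eventually.of_forall fun x => ?_)
  rw [norm_mul]
  exact le_mul_of_one_le_left (norm_nonneg _) (one_le_norm_weight hs x)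

/-- For `s ≥ 0` the space `L^{2,s}` is contained in `L²`. -/
def toL2 (hs : 0 ≤ s) (f : WeightedL2 s) : L2 := (memLp_of_nonneg hs f).toLp _

end WeightedL2

/-! ### The weighted Sobolev space `H^{ℓ,t}`

The unitary Fourier transform `û(ξ) = (2π)^{-3/2} ∫ e^{-ix·ξ} u(x) dx` and Mathlib's
`𝓕 u (ξ) = ∫ e^{-2πix·ξ} u(x) dx` differ by the scaling `ξ ↦ 2πξ`, so that the operator `m(D)` with
symbol `m(ξ)` is `u ↦ 𝓕⁻ (m(2πξ) 𝓕 u)`. -/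

/-- The function `ξ ↦ m(2πξ)`. -/
def rescale (m : R3 → ℂ) (ξ : R3) : ℂ := m ((2 * Real.pi) • ξ)

theorem rescale_weight_hasTemperateGrowth (l : ℝ) : (rescale (weight l)).HasTemperateGrowth :=
  (weight_hasTemperateGrowth l).comp
    (((2 * Real.pi) • ContinuousLinearMap.id ℝ R3).hasTemperateGrowth)

/-- The operator `⟨D⟩ ^ ℓ = (1 - Δ) ^ (ℓ / 2)` on tempered distributions. -/
def bracketD (l : ℝ) : 𝓢'(R3, ℂ) →L[ℂ] 𝓢'(R3, ℂ) :=
  TemperedDistribution.fourierMultiplierCLM ℂ (rescale (weight l))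

/-- The operator `f ↦ ⟨x⟩ ^ t ⟨D⟩ ^ ℓ f` on tempered distributions. -/
def weightBracketD (l t : ℝ) : 𝓢'(R3, ℂ) →L[ℂ] 𝓢'(R3, ℂ) :=
  (TemperedDistribution.smulLeftCLM ℂ (weight t)).comp (bracketD l)

theorem weightBracketD_injective (l t : ℝ) : Function.Injective (weightBracketD l t) := by
  have h1 : Function.Injective (TemperedDistribution.smulLeftCLM (E := R3) ℂ (weight t)) := by
    refine Function.LeftInverse.injective
      (g := TemperedDistribution.smulLeftCLM ℂ (weight (-t))) fun f => ?_
    rw [TemperedDistribution.smulLeftCLM_smulLeftCLM_apply (weight_hasTemperateGrowth t)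
      (weight_hasTemperateGrowth (-t)), weight_mul_neg]
    simp
  have h2 : Function.Injective (bracketD l) := by
    refine Function.LeftInverse.injective (g := bracketD (-l)) fun f => ?_
    unfold bracketD
    rw [TemperedDistribution.fourierMultiplierCLM_fourierMultiplierCLM_apply
      (rescale_weight_hasTemperateGrowth l) (rescale_weight_hasTemperateGrowth (-l))]
    have : rescale (weight l) * rescale (weight (-l)) = fun _ => 1 := by
      funext ξ
      exact congrFun (weight_mul_neg l) ((2 * Real.pi) • ξ)
    rw [this]
    simp
  exact h1.comp h2

/-- The inclusion of `L²` into the tempered distributions. -/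
def ofL2 : L2 →ₗ[ℂ] 𝓢'(R3, ℂ) := (Lp.toTemperedDistributionCLM ℂ (volume : Measure R3) 2 : _ →L[ℂ] _)

theorem ofL2_injective : Function.Injective ofL2 :=
  LinearMap.ker_eq_bot.1 Lp.ker_toTemperedDistributionCLM_eq_bot

/-- The tempered distributions `f` with `⟨x⟩ ^ t ⟨D⟩ ^ ℓ f ∈ L²`. -/
def weightedSobolevSubmodule (l t : ℝ) : Submodule ℂ 𝓢'(R3, ℂ) :=
  (LinearMap.range ofL2).comap (weightBracketD l t : 𝓢'(R3, ℂ) →ₗ[ℂ] 𝓢'(R3, ℂ))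

/-- The weighted Sobolev space `H^{ℓ,t}(ℝ³) = {f | ⟨x⟩ ^ t ⟨D⟩ ^ ℓ f ∈ L²}`. -/
def WeightedSobolev (l t : ℝ) : Type := ↥(weightedSobolevSubmodule l t)

namespace WeightedSobolev

variable {l t : ℝ}

instance : AddCommGroup (WeightedSobolev l t) :=
  inferInstanceAs (AddCommGroup ↥(weightedSobolevSubmodule l t))

instance : Module ℂ (WeightedSobolev l t) :=
  inferInstanceAs (Module ℂ ↥(weightedSobolevSubmodule l t))

/-- The underlying tempered distribution. -/
def toDistribution : WeightedSobolev l t →ₗ[ℂ] 𝓢'(R3, ℂ) := (weightedSobolevSubmodule l t).subtype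

theorem mem_range (f : WeightedSobolev l t) :
    weightBracketD l t (toDistribution f) ∈ LinearMap.range ofL2 :=
  Subtype.prop (p := fun g => g ∈ weightedSobolevSubmodule l t) f

/-- The map `f ↦ ⟨x⟩ ^ t ⟨D⟩ ^ ℓ f` from `H^{ℓ,t}` to `L²`. -/
def mulWeight : WeightedSobolev l t →ₗ[ℂ] L2 :=
  (LinearEquiv.ofInjective ofL2 ofL2_injective).symm.toLinearMap.comp
    (((weightBracketD l t : 𝓢'(R3, ℂ) →ₗ[ℂ] 𝓢'(R3, ℂ)).comp toDistribution).codRestrict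
      (LinearMap.range ofL2) mem_range)

theorem ofL2_mulWeight (f : WeightedSobolev l t) :
    ofL2 (mulWeight f) = weightBracketD l t (toDistribution f) :=
  congrArg Subtype.val ((LinearEquiv.ofInjective ofL2 ofL2_injective).apply_symm_apply
    ⟨weightBracketD l t (toDistribution f), mem_range f⟩)

theorem mulWeight_injective : Function.Injective (mulWeight (l := l) (t := t)) := by
  intro f g h
  have h' := congrArg ofL2 h
  rw [ofL2_mulWeight, ofL2_mulWeight] at h'
  exact Subtype.ext (weightBracketD_injective l t h')

/-- The norm of `H^{ℓ,t}` is `‖f‖ = ‖⟨x⟩ ^ t ⟨D⟩ ^ ℓ f‖_{L²}`. -/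
instance : NormedAddCommGroup (WeightedSobolev l t) :=
  NormedAddCommGroup.induced (WeightedSobolev l t) L2 mulWeight mulWeight_injective

instance : NormedSpace ℂ (WeightedSobolev l t) :=
  NormedSpace.induced ℂ (WeightedSobolev l t) L2 mulWeight

theorem norm_def (f : WeightedSobolev l t) : ‖f‖ = ‖mulWeight f‖ := rfl

end WeightedSobolev

/-! ### The operators `B(z)` -/

/-- The rectangle `D_{ab} = {λ + iμ | a ≤ λ ≤ b, |μ| ≤ a / 2}`. -/
def rectD (a b : ℝ) : Set ℂ := {z | a ≤ z.re ∧ z.re ≤ b ∧ |z.im| ≤ a / 2}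

/-- `γ ∈ C₀^∞(ℝ³)` is `1` where `a² / 2 ≤ |ξ|² ≤ 3 b² / 2`, and `0` where `|ξ|² ≤ a² / 4` or
`2 b² ≤ |ξ|²`. -/
structure IsCutoff (a b : ℝ) (γ : R3 → ℂ) : Prop where
  contDiff : ContDiff ℝ ∞ γ
  hasCompactSupport : HasCompactSupport γ
  eq_one : ∀ ξ : R3, 1 / 2 * a ^ 2 ≤ ‖ξ‖ ^ 2 → ‖ξ‖ ^ 2 ≤ 3 / 2 * b ^ 2 → γ ξ = 1
  eq_zero_low : ∀ ξ : R3, ‖ξ‖ ^ 2 ≤ 1 / 4 * a ^ 2 → γ ξ = 0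
  eq_zero_high : ∀ ξ : R3, 2 * b ^ 2 ≤ ‖ξ‖ ^ 2 → γ ξ = 0

/-- The symbol `(1 - γ(ξ)) |ξ| / (|ξ|² - z²)` of `B(z)`. For `z ∈ D_{ab}` the factor `1 - γ(ξ)`
vanishes near the zeros of the denominator. -/
def symbolB (γ : R3 → ℂ) (z : ℂ) (ξ : R3) : ℂ :=
  (1 - γ ξ) * (‖ξ‖ : ℂ) / ((‖ξ‖ : ℂ) ^ 2 - z ^ 2)

theorem symbolB_bounded {a b : ℝ} (ha : 0 < a) (hab : a < b) {γ : R3 → ℂ} (hγ : IsCutoff a b γ)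
    {z : ℂ} (hz : z ∈ rectD a b) : ∃ C : ℝ, ∀ ξ : R3, ‖symbolB γ z ξ‖ ≤ C := by
  obtain ⟨M, hM⟩ := hγ.hasCompactSupport.exists_bound_of_continuous hγ.contDiff.continuous
  obtain ⟨h1, h2, h3⟩ := hz
  have hM0 : 0 ≤ M := (norm_nonneg _).trans (hM 0)
  have him : z.im ^ 2 ≤ (a / 2) ^ 2 := sq_le_sq' (by linarith [abs_le.1 h3]) (abs_le.1 h3).2
  have hre : ∀ ξ : R3, (((‖ξ‖ : ℂ) ^ 2 - z ^ 2)).re = ‖ξ‖ ^ 2 - (z.re ^ 2 - z.im ^ 2) := by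
    intro ξ
    simp [sq]
  have hb : 0 < b := ha.trans hab
  refine ⟨(1 + M) * a / (1 / 4 * a ^ 2) + 3 * (1 + M) / b, fun ξ => ?_⟩
  have hnum : ‖(1 - γ ξ) * (‖ξ‖ : ℂ)‖ ≤ (1 + M) * ‖ξ‖ := by
    rw [norm_mul, Complex.norm_real, norm_norm]
    gcongr
    exact (norm_sub_le _ _).trans (by simpa using hM ξ)
  have hA : 0 ≤ (1 + M) * a / (1 / 4 * a ^ 2) := by positivity
  have hB : 0 ≤ 3 * (1 + M) / b := by positivity
  have habs := Complex.abs_re_le_norm ((‖ξ‖ : ℂ) ^ 2 - z ^ 2)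
  rw [hre] at habs
  unfold symbolB
  rw [norm_div]
  rcases lt_or_ge (‖ξ‖ ^ 2) (1 / 2 * a ^ 2) with hlo | hlo
  · have hden : 1 / 4 * a ^ 2 ≤ ‖(‖ξ‖ : ℂ) ^ 2 - z ^ 2‖ := by
      refine le_trans ?_ habs
      rw [abs_sub_comm]
      refine le_trans ?_ (le_abs_self _)
      nlinarith
    have hξ : ‖ξ‖ ≤ a := by nlinarith [norm_nonneg ξ]
    have : ‖(1 - γ ξ) * (‖ξ‖ : ℂ)‖ / ‖(‖ξ‖ : ℂ) ^ 2 - z ^ 2‖ ≤ (1 + M) * a / (1 / 4 * a ^ 2) := by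
      refine div_le_div₀ (by positivity) (hnum.trans (by gcongr)) (by positivity) hden
    linarith
  rcases le_or_gt (‖ξ‖ ^ 2) (3 / 2 * b ^ 2) with hhi | hhi
  · rw [hγ.eq_one ξ hlo hhi]
    simp only [sub_self, zero_mul, norm_zero, zero_div]
    positivity
  · have hden : 1 / 3 * ‖ξ‖ ^ 2 ≤ ‖(‖ξ‖ : ℂ) ^ 2 - z ^ 2‖ := by
      refine le_trans ?_ (habs.trans' (le_abs_self _))
      nlinarith [sq_nonneg z.im]
    have hξ : b ≤ ‖ξ‖ := by nlinarith [norm_nonneg ξ]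
    have hξ0 : 0 < ‖ξ‖ := hb.trans_le hξ
    have : ‖(1 - γ ξ) * (‖ξ‖ : ℂ)‖ / ‖(‖ξ‖ : ℂ) ^ 2 - z ^ 2‖ ≤ 3 * (1 + M) / b := by
      calc _ ≤ ((1 + M) * ‖ξ‖) / (1 / 3 * ‖ξ‖ ^ 2) :=
            div_le_div₀ (by positivity) hnum (by positivity) hden
        _ = 3 * (1 + M) / ‖ξ‖ := by field_simp
        _ ≤ 3 * (1 + M) / b := by gcongr
    linarith

theorem symbolB_memLp {a b : ℝ} (ha : 0 < a) (hab : a < b) {γ : R3 → ℂ} (hγ : IsCutoff a b γ)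
    {z : ℂ} (hz : z ∈ rectD a b) : MemLp (rescale (symbolB γ z)) ∞ (volume : Measure R3) := by
  obtain ⟨C, hC⟩ := symbolB_bounded ha hab hγ hz
  refine memLp_top_of_bound (Measurable.aestronglyMeasurable ?_) C
    (Filter.Eventually.of_forall fun ξ => hC _)
  have hm : Measurable γ := hγ.contDiff.continuous.measurable
  unfold rescale symbolB
  fun_prop

/-- The bounded operator `m(D)` on `L²`, for an essentially bounded symbol `m`:
`u ↦ 𝓕⁻ (m(2πξ) 𝓕 u)`. -/
def multiplier (m : R3 → ℂ) (hm : MemLp (rescale m) ∞ (volume : Measure R3)) : L2 →L[ℂ] L2 :=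
  (Lp.fourierTransformₗᵢ R3 ℂ).symm.toContinuousLinearEquiv.toContinuousLinearMap.comp
    ((((ContinuousLinearMap.mul ℂ ℂ).holderL (volume : Measure R3) ∞ 2 2) (hm.toLp _)).comp
      (Lp.fourierTransformₗᵢ R3 ℂ).toContinuousLinearEquiv.toContinuousLinearMap)

theorem fourier_multiplier (m : R3 → ℂ) (hm : MemLp (rescale m) ∞ (volume : Measure R3)) (u : L2) :
    (𝓕 (multiplier m hm u) : L2) =ᵐ[volume] fun ξ => rescale m ξ * (𝓕 u : L2) ξ := by
  have h : (𝓕 (multiplier m hm u) : L2) =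
      ((ContinuousLinearMap.mul ℂ ℂ).holderL (volume : Measure R3) ∞ 2 2) (hm.toLp _) (𝓕 u : L2) :=
    (Lp.fourierTransformₗᵢ R3 ℂ).apply_symm_apply _
  rw [h]
  filter_upwards [(ContinuousLinearMap.mul ℂ ℂ).coeFn_holder (r := 2) (hm.toLp _) (𝓕 u : L2),
    hm.coeFn_toLp] with ξ h1 h2
  exact h1.trans (by rw [h2]; rfl)

/-- The operator `B(z) = (1 - γ(D)) |D| (|D|² - z²)⁻¹` on `L²`, for `z ∈ D_{ab}`. -/
def opB {a b : ℝ} (ha : 0 < a) (hab : a < b) {γ : R3 → ℂ} (hγ : IsCutoff a b γ)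
    (z : rectD a b) : L2 →L[ℂ] L2 :=
  multiplier (symbolB γ z) (symbolB_memLp ha hab hγ z.2)

end SqrtLaplacian

end

noncomputable section

namespace SqrtLaplacian

/-! The hypotheses force `t < 1`, and `s > 3/2` whenever `t > 0`. So either `t ≤ 0`, where
boundedness on L² is enough, or `t ≤ 1 ≤ s`, where boundedness on L^{2,1} is enough. Under the
Fourier transform L^{2,1} becomes the Sobolev space H¹, which is preserved by multiplication by any
bounded Lipschitz function. No further smoothness of the symbol is needed, and none is available,
since |ξ| has a corner at the origin.

Two facts carry the proof. By `exists_boundedLipschitzOn_weight_mul_symbolB`, ⟨ξ⟩ times the symbol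
of B(z) is bounded and Lipschitz with a constant uniform in z, and for the difference of two such
symbols the constant is a multiple of |z² - w²|, by the resolvent identity. By
`eLpNorm_weight_one_mul_multiplier_le`, a bounded Lipschitz multiplier preserves L^{2,1}, with norm
controlled by the constant of the symbol. Applied to ⟨D⟩B(z) these give boundedness; applied to
⟨D⟩(B(z) - B(w)) they give continuity in operator norm. -/

/-- `f` is bounded by `C` and `C`-Lipschitz on `S`. -/
def BoundedLipschitzOn (C : ℝ) (S : Set R3) (f : R3 → ℂ) : Prop :=
  (∀ x ∈ S, ‖f x‖ ≤ C) ∧ ∀ x ∈ S, ∀ y ∈ S, ‖f x - f y‖ ≤ C * ‖x - y‖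

/-! ### Algebra of bounded Lipschitz functions -/

namespace BoundedLipschitzOn

variable {C C' : ℝ} {S : Set R3} {f g : R3 → ℂ}

theorem mono (hf : BoundedLipschitzOn C S f) (h : C ≤ C') : BoundedLipschitzOn C' S f :=
  ⟨fun x hx => (hf.1 x hx).trans h, fun x hx y hy => (hf.2 x hx y hy).trans (by gcongr)⟩

theorem congr (hf : BoundedLipschitzOn C S f) (h : ∀ x ∈ S, g x = f x) :
    BoundedLipschitzOn C S g :=
  ⟨fun x hx => h x hx ▸ hf.1 x hx, fun x hx y hy => h x hx ▸ h y hy ▸ hf.2 x hx y hy⟩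

theorem const (c : ℂ) (S : Set R3) : BoundedLipschitzOn ‖c‖ S fun _ => c :=
  ⟨fun _ _ => le_rfl, fun x _ y _ => by simp only [sub_self, norm_zero]; positivity⟩

theorem add (hf : BoundedLipschitzOn C S f) (hg : BoundedLipschitzOn C' S g) :
    BoundedLipschitzOn (C + C') S fun x => f x + g x := by
  refine ⟨fun x hx => (norm_add_le _ _).trans (add_le_add (hf.1 x hx) (hg.1 x hx)),
    fun x hx y hy => ?_⟩
  rw [add_sub_add_comm, add_mul]
  exact (norm_add_le _ _).trans (add_le_add (hf.2 x hx y hy) (hg.2 x hx y hy))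

theorem const_mul (hf : BoundedLipschitzOn C S f) (c : ℂ) :
    BoundedLipschitzOn (C * ‖c‖) S fun x => c * f x := by
  refine ⟨fun x hx => ?_, fun x hx y hy => ?_⟩
  · rw [norm_mul, mul_comm]
    exact mul_le_mul_of_nonneg_right (hf.1 x hx) (norm_nonneg c)
  · rw [← mul_sub, norm_mul, mul_comm C, mul_assoc]
    exact mul_le_mul_of_nonneg_left (hf.2 x hx y hy) (norm_nonneg c)

theorem mul (hf : BoundedLipschitzOn C S f) (hg : BoundedLipschitzOn C' S g) (hC : 0 ≤ C)
    (hC' : 0 ≤ C') : BoundedLipschitzOn (2 * (C * C')) S fun x => f x * g x := by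
  refine ⟨fun x hx => ?_, fun x hx y hy => ?_⟩
  · rw [norm_mul]
    have := mul_le_mul (hf.1 x hx) (hg.1 x hx) (norm_nonneg _) hC
    nlinarith [mul_nonneg hC hC']
  · have : f x * g x - f y * g y = f x * (g x - g y) + (f x - f y) * g y := by ring
    rw [this]
    refine (norm_add_le _ _).trans ?_
    rw [norm_mul, norm_mul]
    have h1 := mul_le_mul (hf.1 x hx) (hg.2 x hx y hy) (norm_nonneg _) hC
    have h2 := mul_le_mul (hf.2 x hx y hy) (hg.1 y hy) (norm_nonneg _) (by positivity)
    linarith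

/-- A bounded Lipschitz function vanishing off `S` times a bounded Lipschitz function on `S`. -/
theorem mul_of_eq_zero (hf : BoundedLipschitzOn C Set.univ f) (hf0 : ∀ x ∉ S, f x = 0)
    (hg : BoundedLipschitzOn C' S g) (hC : 0 ≤ C) (hC' : 0 ≤ C') :
    BoundedLipschitzOn (2 * (C * C')) Set.univ fun x => f x * g x := by
  have hfS : BoundedLipschitzOn C S f :=
    ⟨fun x _ => hf.1 x trivial, fun x _ y _ => hf.2 x trivial y trivial⟩
  have hfg := hfS.mul hg hC hC'
  have hCC : 0 ≤ C * C' := mul_nonneg hC hC'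
  -- The mixed case needs no geometry of `S`: since `f y = 0`, the Lipschitz bound makes `f x`
  -- itself of size `C * ‖x - y‖`.
  have key : ∀ x ∈ S, ∀ y ∉ S, ‖f x * g x‖ ≤ 2 * (C * C') * ‖x - y‖ := by
    intro x hx y hy
    have h1 := hf.2 x trivial y trivial
    rw [hf0 y hy, sub_zero] at h1
    rw [norm_mul]
    have := mul_le_mul h1 (hg.1 x hx) (norm_nonneg _) (by positivity)
    nlinarith [mul_nonneg hCC (norm_nonneg (x - y))]
  refine ⟨fun x _ => ?_, fun x _ y _ => ?_⟩
  · by_cases hx : x ∈ S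
    · exact hfg.1 x hx
    · simp only [hf0 x hx, zero_mul, norm_zero]
      positivity
  · by_cases hx : x ∈ S <;> by_cases hy : y ∈ S
    · exact hfg.2 x hx y hy
    · simpa [hf0 y hy] using key x hx y hy
    · simpa [hf0 x hx, norm_sub_rev x y] using key y hy x hx
    · simp only [hf0 x hx, hf0 y hy, zero_mul, sub_zero, norm_zero]
      positivity

/-- The dilation costs a factor 2π in the Lipschitz constant, rounded up to 7. -/
theorem rescale (hf : BoundedLipschitzOn C Set.univ f) (hC : 0 ≤ C) :
    BoundedLipschitzOn (7 * C) Set.univ (rescale f) := by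
  refine ⟨fun x _ => (hf.1 _ trivial).trans (by linarith), fun x _ y _ => ?_⟩
  refine (hf.2 _ trivial _ trivial).trans ?_
  rw [← smul_sub, norm_smul, Real.norm_eq_abs, abs_of_pos (by positivity)]
  have : 2 * Real.pi ≤ 7 := by linarith [Real.pi_lt_d2]
  nlinarith [mul_nonneg hC (norm_nonneg (x - y))]

theorem continuous (hf : BoundedLipschitzOn C Set.univ f) : Continuous f := by
  refine (LipschitzWith.of_dist_le_mul (K := C.toNNReal) fun x y => ?_).continuous
  rw [dist_eq_norm, dist_eq_norm]
  exact (hf.2 x trivial y trivial).trans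
    (mul_le_mul_of_nonneg_right (Real.le_coe_toNNReal C) (norm_nonneg _))

theorem memLp_top (hf : BoundedLipschitzOn C Set.univ f) : MemLp f ∞ (volume : Measure R3) :=
  memLp_top_of_bound hf.continuous.aestronglyMeasurable C
    (Filter.Eventually.of_forall fun x => hf.1 x trivial)

end BoundedLipschitzOn

/-! ### Estimates for the symbol -/

theorem bracket_pos (x : R3) : 0 < bracket x := by linarith [one_le_bracket x]

theorem bracket_sq (x : R3) : bracket x ^ 2 = 1 + ‖x‖ ^ 2 := Real.sq_sqrt (by positivity)

theorem norm_le_bracket (x : R3) : ‖x‖ ≤ bracket x := by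
  nlinarith [bracket_sq x, bracket_pos x, norm_nonneg x]

theorem weight_one (x : R3) : weight 1 x = (bracket x : ℂ) := by simp [weight]

/-- The squares ⟨x⟩² and |x|² differ by a constant, so ⟨x⟩² - ⟨y⟩² = |x|² - |y|²; then divide by ⟨x⟩
+ ⟨y⟩ ≥ |x| + |y|. -/
theorem abs_bracket_sub_bracket_le (x y : R3) : |bracket x - bracket y| ≤ ‖x - y‖ := by
  refine le_trans ?_ (abs_norm_sub_norm_le x y)
  have hpos : 0 < bracket x + bracket y := add_pos (bracket_pos x) (bracket_pos y)
  refine le_of_mul_le_mul_right ?_ hpos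
  have h : |bracket x - bracket y| * (bracket x + bracket y) =
      |‖x‖ - ‖y‖| * (‖x‖ + ‖y‖) := by
    rw [← abs_of_pos hpos, ← abs_mul, ← abs_of_nonneg (add_nonneg (norm_nonneg x) (norm_nonneg y)),
      ← abs_mul]
    congr 1
    linear_combination bracket_sq x - bracket_sq y
  rw [h]
  gcongr
  · exact norm_le_bracket x
  · exact norm_le_bracket y

theorem boundedLipschitzOn_norm_div_bracket :
    BoundedLipschitzOn 2 Set.univ fun x : R3 => ((‖x‖ / bracket x : ℝ) : ℂ) := by
  have hle : ∀ x : R3, ‖x‖ / bracket x ≤ 1 := fun x =>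
    (div_le_one (bracket_pos x)).2 (norm_le_bracket x)
  have hnn : ∀ x : R3, 0 ≤ ‖x‖ / bracket x := fun x =>
    div_nonneg (norm_nonneg x) (bracket_pos x).le
  refine ⟨fun x _ => ?_, fun x _ y _ => ?_⟩
  · rw [Complex.norm_real, Real.norm_eq_abs, abs_of_nonneg (hnn x)]
    linarith [hle x]
  · rw [← Complex.ofReal_sub, Complex.norm_real, Real.norm_eq_abs]
    have hx := bracket_pos x
    have hy := bracket_pos y
    have h : ‖x‖ / bracket x - ‖y‖ / bracket y = (bracket x)⁻¹ *
        ((‖x‖ - ‖y‖) + ‖y‖ / bracket y * (bracket y - bracket x)) := by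
      field_simp
      ring
    rw [h, abs_mul, abs_of_pos (inv_pos.2 hx)]
    have h1 : |(‖x‖ - ‖y‖) + ‖y‖ / bracket y * (bracket y - bracket x)| ≤ 2 * ‖x - y‖ := by
      refine (abs_add_le _ _).trans ?_
      rw [abs_mul, abs_of_nonneg (hnn y)]
      have h2 := abs_norm_sub_norm_le x y
      have h3 := abs_bracket_sub_bracket_le y x
      rw [norm_sub_rev] at h3
      have h4 := mul_le_mul (hle y) h3 (abs_nonneg _) zero_le_one
      linarith
    calc (bracket x)⁻¹ * _ ≤ 1 * (2 * ‖x - y‖) :=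
          mul_le_mul (inv_le_one_of_one_le₀ (one_le_bracket x)) h1 (abs_nonneg _) zero_le_one
      _ = 2 * ‖x - y‖ := one_mul _

/-- The region outside the annulus on which cutoffs are required to be `1`. -/
def outsideAnnulus (a b : ℝ) : Set R3 := {ξ | ‖ξ‖ ^ 2 ≤ 1 / 2 * a ^ 2 ∨ 3 / 2 * b ^ 2 ≤ ‖ξ‖ ^ 2}

/-- The symbol `(|ξ|² - z²)⁻¹` of the resolvent of the Laplacian. -/
def resolventSymbol (z : ℂ) (ξ : R3) : ℂ := ((‖ξ‖ : ℂ) ^ 2 - z ^ 2)⁻¹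

/-- The real part of |ξ|² - z² is |ξ|² - (λ² - μ²), and λ² - μ² lies between 3a²/4 and b² on the
rectangle. Inside the annulus this leaves a gap of at least a²/4, beyond it a gap of at least
|ξ|²/3. -/
theorem exists_one_add_norm_sq_le {a b : ℝ} (ha : 0 < a) (hab : a < b) :
    ∃ C : ℝ, 1 ≤ C ∧ ∀ z ∈ rectD a b, ∀ ξ ∈ outsideAnnulus a b,
      1 + ‖ξ‖ ^ 2 ≤ C * ‖(‖ξ‖ : ℂ) ^ 2 - z ^ 2‖ := by
  have hb : 0 < b := ha.trans hab
  have hA : 0 < 4 / a ^ 2 := by positivity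
  have hB : 0 < 2 / b ^ 2 := by positivity
  -- `4 / a ^ 2 + 2` suffices for small ξ and `3 + 2 / b ^ 2` for large ξ; their sum covers both.
  refine ⟨4 / a ^ 2 + 2 + 3 + 2 / b ^ 2, by linarith, ?_⟩
  rintro z ⟨h1, h2, h3⟩ ξ hξ
  have him : z.im ^ 2 ≤ (a / 2) ^ 2 := sq_le_sq' (by linarith [abs_le.1 h3]) (abs_le.1 h3).2
  have hre : ((‖ξ‖ : ℂ) ^ 2 - z ^ 2).re = ‖ξ‖ ^ 2 - (z.re ^ 2 - z.im ^ 2) := by simp [sq]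
  have habs := Complex.abs_re_le_norm ((‖ξ‖ : ℂ) ^ 2 - z ^ 2)
  rw [hre] at habs
  have hN := norm_nonneg ((‖ξ‖ : ℂ) ^ 2 - z ^ 2)
  rcases hξ with hlo | hhi
  · have hden : 1 / 4 * a ^ 2 ≤ ‖(‖ξ‖ : ℂ) ^ 2 - z ^ 2‖ := by
      refine le_trans ?_ habs
      rw [abs_sub_comm]
      refine le_trans ?_ (le_abs_self _)
      nlinarith
    have h4 : (4 / a ^ 2 + 2) * (1 / 4 * a ^ 2) = 1 + 1 / 2 * a ^ 2 := by field_simp; ring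
    have h5 : (4 / a ^ 2 + 2) * (1 / 4 * a ^ 2) ≤
        (4 / a ^ 2 + 2) * ‖(‖ξ‖ : ℂ) ^ 2 - z ^ 2‖ := by gcongr
    nlinarith [mul_nonneg hB.le hN]
  · have hden : 1 / 3 * ‖ξ‖ ^ 2 ≤ ‖(‖ξ‖ : ℂ) ^ 2 - z ^ 2‖ := by
      refine le_trans ?_ (habs.trans' (le_abs_self _))
      nlinarith [sq_nonneg z.im]
    have h5 : (3 + 2 / b ^ 2) * (1 / 3 * ‖ξ‖ ^ 2) ≤
        (3 + 2 / b ^ 2) * ‖(‖ξ‖ : ℂ) ^ 2 - z ^ 2‖ := by gcongr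
    have h6 : 2 / b ^ 2 * (1 / 3 * (3 / 2 * b ^ 2)) ≤ 2 / b ^ 2 * (1 / 3 * ‖ξ‖ ^ 2) := by gcongr
    have h7 : 2 / b ^ 2 * (1 / 3 * (3 / 2 * b ^ 2)) = 1 := by field_simp
    nlinarith [mul_nonneg hA.le hN]

/-- The difference of two values carries the factor |y|² - |x|², whose growing part |x| + |y| is
absorbed by the quadratic decay of the two resolvent factors. -/
theorem boundedLipschitzOn_resolventSymbol {S : Set R3} {z : ℂ} {C : ℝ} (hC : 1 ≤ C)
    (h : ∀ ξ ∈ S, 1 + ‖ξ‖ ^ 2 ≤ C * ‖(‖ξ‖ : ℂ) ^ 2 - z ^ 2‖) :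
    BoundedLipschitzOn (C ^ 2) S (resolventSymbol z) := by
  have hpos : ∀ ξ ∈ S, 0 < ‖(‖ξ‖ : ℂ) ^ 2 - z ^ 2‖ := fun ξ hξ => by
    have := h ξ hξ
    by_contra hn
    nlinarith [sq_nonneg ‖ξ‖]
  have hbd : ∀ ξ ∈ S, ‖resolventSymbol z ξ‖ ≤ C / (1 + ‖ξ‖ ^ 2) := fun ξ hξ => by
    rw [resolventSymbol, norm_inv, inv_eq_one_div, div_le_div_iff₀ (hpos ξ hξ) (by positivity)]
    linarith [h ξ hξ]
  refine ⟨fun x hx => (hbd x hx).trans ?_, fun x hx y hy => ?_⟩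
  · refine (div_le_self (by linarith) (by nlinarith [sq_nonneg ‖x‖])).trans (by nlinarith)
  · have hx0 := norm_pos_iff.1 (hpos x hx)
    have hy0 := norm_pos_iff.1 (hpos y hy)
    have heq : resolventSymbol z x - resolventSymbol z y =
        (((‖y‖ - ‖x‖) * (‖x‖ + ‖y‖) : ℝ) : ℂ) * (resolventSymbol z x * resolventSymbol z y) := by
      unfold resolventSymbol
      rw [inv_sub_inv hx0 hy0, ← mul_inv, div_eq_mul_inv]
      congr 1
      push_cast
      ring
    rw [heq, norm_mul, norm_mul, Complex.norm_real, norm_mul, Real.norm_eq_abs, Real.norm_eq_abs,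
      abs_of_nonneg (a := ‖x‖ + ‖y‖) (by positivity), abs_sub_comm]
    have h1 := mul_le_mul (hbd x hx) (hbd y hy) (norm_nonneg _) (by positivity)
    have h2 := abs_norm_sub_norm_le x y
    have h3 : (‖x‖ + ‖y‖) * (C / (1 + ‖x‖ ^ 2) * (C / (1 + ‖y‖ ^ 2))) ≤ C ^ 2 := by
      rw [div_mul_div_comm, mul_div_assoc', div_le_iff₀ (by positivity)]
      nlinarith [mul_nonneg (sq_nonneg C) (sq_nonneg (‖x‖ - 1)),
        mul_nonneg (sq_nonneg C) (sq_nonneg (‖y‖ - 1)), sq_nonneg (C * ‖x‖), sq_nonneg (C * ‖y‖),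
        sq_nonneg (C * ‖x‖ * ‖y‖), sq_nonneg C]
    calc |‖x‖ - ‖y‖| * (‖x‖ + ‖y‖) * (‖resolventSymbol z x‖ * ‖resolventSymbol z y‖)
        ≤ |‖x‖ - ‖y‖| * (‖x‖ + ‖y‖) * (C / (1 + ‖x‖ ^ 2) * (C / (1 + ‖y‖ ^ 2))) := by gcongr
      _ = ((‖x‖ + ‖y‖) * (C / (1 + ‖x‖ ^ 2) * (C / (1 + ‖y‖ ^ 2)))) * |‖x‖ - ‖y‖| := by ring
      _ ≤ C ^ 2 * ‖x - y‖ := by gcongr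

theorem IsCutoff.exists_boundedLipschitzOn {a b : ℝ} {γ : R3 → ℂ} (hγ : IsCutoff a b γ) :
    ∃ C : ℝ, 0 ≤ C ∧ BoundedLipschitzOn C Set.univ fun ξ => 1 - γ ξ := by
  obtain ⟨M, hM⟩ := hγ.hasCompactSupport.exists_bound_of_continuous hγ.contDiff.continuous
  obtain ⟨K, hK⟩ := ContDiff.lipschitzWith_of_hasCompactSupport hγ.hasCompactSupport hγ.contDiff
    (by simp)
  have hM0 : 0 ≤ M := (norm_nonneg _).trans (hM 0)
  refine ⟨1 + M + K, by positivity, fun x _ => ?_, fun x _ y _ => ?_⟩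
  · refine (norm_sub_le _ _).trans ?_
    rw [norm_one]
    linarith [hM x, K.2]
  · rw [sub_sub_sub_cancel_left, norm_sub_rev]
    have := hK.dist_le_mul x y
    rw [dist_eq_norm, dist_eq_norm] at this
    nlinarith [norm_nonneg (x - y)]

/-- The product ⟨ξ⟩ · symbol factors as `G` times (1 + |ξ|²)/(|ξ|² - z²), where `G` = (1 - γ)|ξ|/⟨ξ⟩
is bounded and Lipschitz everywhere and vanishes off `S`. The second factor therefore only has to be
controlled on `S`, where it equals 1 + (1 + z²)/(|ξ|² - z²). -/
theorem exists_boundedLipschitzOn_weight_mul_symbolB {a b : ℝ} (ha : 0 < a) (hab : a < b)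
    {γ : R3 → ℂ} (hγ : IsCutoff a b γ) :
    ∃ C : ℝ, 0 ≤ C ∧
      (∀ z ∈ rectD a b, BoundedLipschitzOn C Set.univ fun ξ => weight 1 ξ * symbolB γ z ξ) ∧
      ∀ z ∈ rectD a b, ∀ w ∈ rectD a b, BoundedLipschitzOn (C * ‖z ^ 2 - w ^ 2‖) Set.univ
        fun ξ => weight 1 ξ * (symbolB γ z ξ - symbolB γ w ξ) := by
  obtain ⟨C₀, hC₀, hden⟩ := exists_one_add_norm_sq_le ha hab
  obtain ⟨C₁, hC₁, hcut⟩ := hγ.exists_boundedLipschitzOn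
  set S := outsideAnnulus a b
  set G : R3 → ℂ := fun ξ => (1 - γ ξ) * ((‖ξ‖ / bracket ξ : ℝ) : ℂ)
  have hG : BoundedLipschitzOn (2 * (C₁ * 2)) Set.univ G :=
    hcut.mul boundedLipschitzOn_norm_div_bracket hC₁ zero_le_two
  have hG0 : ∀ ξ ∉ S, G ξ = 0 := by
    intro ξ hξ
    simp only [S, outsideAnnulus, Set.mem_ofPred_eq, not_or, not_le] at hξ
    simp [G, hγ.eq_one ξ hξ.1.le hξ.2.le]
  have hne : ∀ z ∈ rectD a b, ∀ ξ ∈ S, (‖ξ‖ : ℂ) ^ 2 - z ^ 2 ≠ 0 := by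
    intro z hz ξ hξ h0
    have := hden z hz ξ hξ
    rw [h0, norm_zero, mul_zero] at this
    nlinarith [sq_nonneg ‖ξ‖]
  have hR : ∀ z ∈ rectD a b, BoundedLipschitzOn (C₀ ^ 2) S (resolventSymbol z) := fun z hz =>
    boundedLipschitzOn_resolventSymbol hC₀ (hden z hz)
  -- The summands bound the two terms of 1 + (1 + z²)/(|ξ|² - z²), using |z| ≤ b + a/2.
  set C₂ : ℝ := 1 + C₀ ^ 2 * (1 + (b + a / 2) ^ 2)
  have hQ : ∀ z ∈ rectD a b,
      BoundedLipschitzOn C₂ S fun ξ => (1 + (‖ξ‖ : ℂ) ^ 2) * resolventSymbol z ξ := by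
    intro z hz
    have hz2 : ‖1 + z ^ 2‖ ≤ 1 + (b + a / 2) ^ 2 := by
      refine (norm_add_le _ _).trans ?_
      rw [norm_one, norm_pow]
      have : ‖z‖ ≤ b + a / 2 := by
        refine (Complex.norm_le_abs_re_add_abs_im z).trans (add_le_add ?_ hz.2.2)
        rw [abs_of_pos (ha.trans_le hz.1)]
        exact hz.2.1
      gcongr
    refine (((BoundedLipschitzOn.const 1 S).add ((hR z hz).const_mul (1 + z ^ 2))).mono
      ?_).congr fun ξ hξ => ?_
    · rw [norm_one]
      simp only [C₂]
      gcongr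
    · have := hne z hz ξ hξ
      unfold resolventSymbol
      field_simp
      ring
  have hC₂ : 0 ≤ C₂ := by positivity
  have hbr : ∀ ξ : R3, (bracket ξ : ℂ) ≠ 0 := fun ξ => by
    exact_mod_cast (bracket_pos ξ).ne'
  have hbr2 : ∀ ξ : R3, (bracket ξ : ℂ) ^ 2 = 1 + (‖ξ‖ : ℂ) ^ 2 := fun ξ => by
    exact_mod_cast bracket_sq ξ
  have hsym : ∀ z ξ, weight 1 ξ * symbolB γ z ξ =
      G ξ * ((1 + (‖ξ‖ : ℂ) ^ 2) * resolventSymbol z ξ) := by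
    intro z ξ
    have := hbr ξ
    simp only [weight_one, symbolB, G, resolventSymbol, ← hbr2, div_eq_mul_inv]
    push_cast
    field_simp
  -- The term `C₂` serves the bound for a single z, and `2 * (C₀ ^ 2 * C₂)` the bound for
  -- differences.
  refine ⟨2 * (2 * (C₁ * 2) * (2 * (C₀ ^ 2 * C₂) + C₂)), by positivity, fun z hz => ?_,
    fun z hz w hw => ?_⟩
  · refine ((hG.mul_of_eq_zero hG0 (hQ z hz) (by positivity) hC₂).mono ?_).congr
      fun ξ _ => hsym z ξ
    gcongr
    exact le_add_of_nonneg_left (by positivity)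
  -- Resolvent identity: the difference of the resolvent symbols is z² - w² times their product, and
  -- the growing factor 1 + |ξ|² is given to the one at w.
  · have h := hG.mul_of_eq_zero hG0 (((hR z hz).mul (hQ w hw) (by positivity) hC₂).const_mul
      (z ^ 2 - w ^ 2)) (by positivity) (by positivity)
    refine (h.mono ?_).congr fun ξ _ => ?_
    · have : 2 * (C₁ * 2) * (2 * (C₀ ^ 2 * C₂)) * ‖z ^ 2 - w ^ 2‖ ≤
          2 * (C₁ * 2) * (2 * (C₀ ^ 2 * C₂) + C₂) * ‖z ^ 2 - w ^ 2‖ := by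
        gcongr
        exact le_add_of_nonneg_right hC₂
      linarith
    · rw [mul_sub, hsym, hsym]
      by_cases hξ : ξ ∈ S
      · have h1 := hne z hz ξ hξ
        have h2 := hne w hw ξ hξ
        unfold resolventSymbol
        field_simp
        ring
      · simp [hG0 ξ hξ]


/-! ### Modulations and translations on L² -/

/-- The bounded operator of multiplication by an essentially bounded function. -/
def mulBounded (m : R3 → ℂ) (hm : MemLp m ∞ (volume : Measure R3)) : L2 →L[ℂ] L2 :=
  ((ContinuousLinearMap.mul ℂ ℂ).holderL (volume : Measure R3) ∞ 2 2) (hm.toLp _)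

theorem coeFn_mulBounded (m : R3 → ℂ) (hm : MemLp m ∞ (volume : Measure R3)) (u : L2) :
    mulBounded m hm u =ᵐ[volume] fun x => m x * u x := by
  filter_upwards [(ContinuousLinearMap.mul ℂ ℂ).coeFn_holder (r := 2) (hm.toLp _) u,
    hm.coeFn_toLp] with x h1 h2
  exact h1.trans (by rw [h2]; rfl)

/-- The character `x ↦ e^{-2πi⟨x, h⟩}`. -/
def character (h x : R3) : ℂ := Complex.exp ((-(2 * Real.pi * inner ℝ x h) : ℝ) * Complex.I)

theorem norm_character (h x : R3) : ‖character h x‖ = 1 := Complex.norm_exp_ofReal_mul_I _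

theorem continuous_character (h : R3) : Continuous (character h) := by
  unfold character
  fun_prop

theorem norm_character_sub_one_le (h x : R3) :
    ‖character h x - 1‖ ≤ 2 * Real.pi * ‖h‖ * ‖x‖ := by
  unfold character
  rw [mul_comm _ Complex.I]
  refine (Real.norm_exp_I_mul_ofReal_sub_one_le).trans ?_
  rw [norm_neg, norm_mul, Real.norm_eq_abs, abs_of_pos (by positivity), mul_assoc (_ * _),
    mul_comm ‖h‖]
  gcongr
  exact norm_inner_le_norm x h

theorem memLp_character (h : R3) : MemLp (character h) ∞ (volume : Measure R3) :=
  memLp_top_of_bound (continuous_character h).aestronglyMeasurable 1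
    (Filter.Eventually.of_forall fun x => (norm_character h x).le)

/-- Translation by `h` on `L²`. -/
def translate (h : R3) : L2 →ₗᵢ[ℂ] L2 :=
  Lp.compMeasurePreservingₗᵢ ℂ (fun x => x + h) (measurePreserving_add_right volume h)

theorem coeFn_translate (h : R3) (u : L2) : translate h u =ᵐ[volume] fun x => u (x + h) :=
  Lp.coeFn_compMeasurePreserving u (measurePreserving_add_right volume h)

theorem fourierInv_compSubConst (f : 𝓢(R3, ℂ)) (h x : R3) :
    (𝓕⁻ (f.compSubConstCLM ℂ (-h))) x = character h x * (𝓕⁻ f) x := by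
  rw [SchwartzMap.fourierInv_coe, SchwartzMap.fourierInv_coe, Real.fourierInv_eq',
    Real.fourierInv_eq', ← integral_const_mul]
  rw [← integral_add_right_eq_self
    (fun v => character h x * (Complex.exp (↑(2 * Real.pi * inner ℝ v x) * Complex.I) • f v)) h]
  congr 1
  funext v
  rw [SchwartzMap.compSubConstCLM_apply, sub_neg_eq_add, smul_eq_mul, smul_eq_mul, ← mul_assoc,
    character, ← Complex.exp_add]
  congr 2
  rw [inner_add_left, real_inner_comm h x]
  push_cast
  ring

/-- Both sides are continuous in `w`, so it suffices to check Schwartz functions, where it is a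
change of variables. -/
theorem fourierInv_translate (h : R3) (w : L2) :
    𝓕⁻ (translate h w) = mulBounded (character h) (memLp_character h) (𝓕⁻ w) := by
  refine DenseRange.induction_on
    (p := fun w : L2 => 𝓕⁻ (translate h w) =
      mulBounded (character h) (memLp_character h) (𝓕⁻ w : L2))
    (SchwartzMap.denseRange_toLpCLM (p := 2) (μ := volume) ENNReal.ofNat_ne_top) w
    ?_ ?_
  · exact isClosed_eq ((fourierInvCLM ℂ L2).continuous.comp (translate h).continuous)
      ((mulBounded _ _).continuous.comp (fourierInvCLM ℂ L2).continuous)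
  · intro f
    have h1 : translate h (f.toLp 2 volume) = (f.compSubConstCLM ℂ (-h)).toLp 2 volume := by
      refine Lp.ext ?_
      filter_upwards [coeFn_translate h (f.toLp 2 volume),
        (measurePreserving_add_right volume h).quasiMeasurePreserving.ae (f.coeFn_toLp 2 volume),
        (f.compSubConstCLM ℂ (-h)).coeFn_toLp 2 volume] with x h1 h2 h3
      rw [h1, h2, h3, SchwartzMap.compSubConstCLM_apply, sub_neg_eq_add]
    rw [SchwartzMap.toLpCLM_apply, h1, SchwartzMap.toLp_fourierInv_eq,
      SchwartzMap.toLp_fourierInv_eq]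
    refine Lp.ext ?_
    filter_upwards [(𝓕⁻ (f.compSubConstCLM ℂ (-h))).coeFn_toLp 2 volume,
      coeFn_mulBounded _ (memLp_character h) ((𝓕⁻ f).toLp 2 volume),
      (𝓕⁻ f).coeFn_toLp 2 volume] with x h1 h2 h3
    rw [h1, h2, h3, fourierInv_compSubConst]

/-- The Fourier transform turns modulations into translations. -/
theorem fourier_mulBounded_character (h : R3) (u : L2) :
    𝓕 (mulBounded (character h) (memLp_character h) u) = translate h (𝓕 u) := by
  have := fourierInv_translate h (𝓕 u)
  rw [FourierTransform.fourierInv_fourier_eq] at this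
  rw [← this, FourierTransform.fourier_fourierInv_eq]

theorem fourier_L2_sub (u v : L2) : (𝓕 (u - v) : L2) = 𝓕 u - 𝓕 v :=
  (Lp.fourierTransformₗᵢ R3 ℂ).map_sub u v

/-! ### Multipliers on L² and L^{2,1} -/

theorem norm_multiplier_le {C : ℝ} (m : R3 → ℂ) (hm : MemLp (rescale m) ∞ (volume : Measure R3))
    (hC : ∀ ξ, ‖rescale m ξ‖ ≤ C) (u : L2) : ‖multiplier m hm u‖ ≤ C * ‖u‖ := by
  rw [← Lp.norm_fourier_eq (multiplier m hm u), ← Lp.norm_fourier_eq u]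
  refine Lp.norm_le_mul_norm_of_ae_le_mul ?_
  filter_upwards [fourier_multiplier m hm u] with ξ h
  rw [h, norm_mul]
  gcongr
  exact hC ξ

/-- A discrete product rule on the Fourier side. With `U` = 𝓕u, the increment of `m U` is `m` times
the increment of `U`, plus the increment of `m` times the translate of `U`; the sup bound controls
the first term and the Lipschitz bound the second. -/
theorem norm_character_mul_multiplier_sub_le {C : ℝ} (m : R3 → ℂ)
    (hm : MemLp (rescale m) ∞ (volume : Measure R3))
    (hL : BoundedLipschitzOn C Set.univ (rescale m)) (h : R3) (u : L2) :
    ‖mulBounded (character h) (memLp_character h) (multiplier m hm u) - multiplier m hm u‖ ≤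
      C * ‖mulBounded (character h) (memLp_character h) u - u‖ + C * ‖h‖ * ‖u‖ := by
  rw [← Lp.norm_fourier_eq (_ - multiplier m hm u), ← Lp.norm_fourier_eq (_ - u),
    ← Lp.norm_fourier_eq u, fourier_L2_sub, fourier_L2_sub,
    fourier_mulBounded_character, fourier_mulBounded_character]
  set U : L2 := 𝓕 u
  set V : L2 := 𝓕 (multiplier m hm u)
  have hV : V =ᵐ[volume] fun ξ => rescale m ξ * U ξ := fourier_multiplier m hm u
  have h1 : ‖translate h V - V - mulBounded (rescale m) hm (translate h U - U)‖ ≤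
      (C * ‖h‖) * ‖translate h U‖ := by
    refine Lp.norm_le_mul_norm_of_ae_le_mul ?_
    filter_upwards [Lp.coeFn_sub (translate h V - V) (mulBounded (rescale m) hm (translate h U - U)),
      Lp.coeFn_sub (translate h V) V, Lp.coeFn_sub (translate h U) U, coeFn_translate h V,
      coeFn_translate h U, hV, (measurePreserving_add_right volume h).quasiMeasurePreserving.ae hV,
      coeFn_mulBounded (rescale m) hm (translate h U - U)] with ξ e1 e2 e3 e4 e5 e6 e7 e8
    rw [e1, Pi.sub_apply, e2, Pi.sub_apply, e8, e3, Pi.sub_apply, e4, e5, e6, e7]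
    have : rescale m (ξ + h) * U (ξ + h) - rescale m ξ * U ξ - rescale m ξ * (U (ξ + h) - U ξ) =
      (rescale m (ξ + h) - rescale m ξ) * U (ξ + h) := by ring
    rw [this, norm_mul]
    gcongr
    simpa using hL.2 (ξ + h) trivial ξ trivial
  have h2 : ‖mulBounded (rescale m) hm (translate h U - U)‖ ≤ C * ‖translate h U - U‖ := by
    refine Lp.norm_le_mul_norm_of_ae_le_mul ?_
    filter_upwards [coeFn_mulBounded (rescale m) hm (translate h U - U)] with ξ e
    rw [e, norm_mul]
    gcongr
    exact hL.1 ξ trivial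
  rw [LinearIsometry.norm_map] at h1
  calc ‖translate h V - V‖ ≤ ‖mulBounded (rescale m) hm (translate h U - U)‖ +
        ‖translate h V - V - mulBounded (rescale m) hm (translate h U - U)‖ := norm_le_insert' _ _
    _ ≤ _ := add_le_add h2 h1

theorem tendsto_character_difference_quotient (e x : R3) :
    Filter.Tendsto (fun n : ℕ => ((n : ℂ) + 1) *
      (character (((n : ℝ) + 1)⁻¹ • e) x - 1)) Filter.atTop
      (nhds (((-(2 * Real.pi * inner ℝ x e) : ℝ) : ℂ) * Complex.I)) := by
  set c : ℂ := ((-(2 * Real.pi * inner ℝ x e) : ℝ) : ℂ) * Complex.I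
  have hd : HasDerivAt (fun r : ℝ => Complex.exp ((r : ℂ) * c)) c 0 := by
    have h1 : HasDerivAt (fun r : ℝ => (r : ℂ) * c) (1 * c) 0 :=
      (Complex.ofRealCLM.hasDerivAt (x := (0 : ℝ))).mul_const c
    simpa using h1.cexp
  have hs := hd.tendsto_slope_zero_right.comp
    (f := fun n : ℕ => ((n : ℝ) + 1)⁻¹) (x := Filter.atTop) ?_
  · refine hs.congr fun n => ?_
    simp only [Function.comp_apply, zero_add, Complex.ofReal_zero, zero_mul, Complex.exp_zero,
      inv_inv, character, inner_smul_right, c, Complex.real_smul]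
    push_cast
    congr 3
    ring_nf
  · refine tendsto_nhdsWithin_iff.2 ⟨?_, Filter.Eventually.of_forall fun n => ?_⟩
    · simpa [one_div] using tendsto_one_div_add_atTop_nhds_zero_nat (𝕜 := ℝ)
    · exact inv_pos.2 (by positivity : (0 : ℝ) < (n : ℝ) + 1)

theorem norm_le_norm_toLp_weight_mul {s : ℝ} (hs : 0 ≤ s) {u : L2}
    (hu : MemLp (fun x => weight s x * u x) 2 volume) : ‖u‖ ≤ ‖hu.toLp _‖ := by
  refine Lp.norm_le_norm_of_ae_le ?_
  filter_upwards [hu.coeFn_toLp] with x hx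
  rw [hx, norm_mul]
  exact le_mul_of_one_le_left (norm_nonneg _) (one_le_norm_weight hs x)

/-- Multiplication by ⟨x, e⟩ is, up to the constant -2πi, the limit of the difference quotients of
modulations in the direction `e`. These are bounded in L² uniformly in the step, and Fatou's lemma
passes the bound to the limit, so it need not be known beforehand that the limit lies in L². -/
theorem eLpNorm_inner_mul_multiplier_le {C D : ℝ} (hC : 0 ≤ C) (m : R3 → ℂ)
    (hm : MemLp (rescale m) ∞ (volume : Measure R3))
    (hL : BoundedLipschitzOn C Set.univ (rescale m)) (u : L2)
    (hu : MemLp (fun x => weight 1 x * u x) 2 volume)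
    (hD : ‖hu.toLp _‖ ≤ D) (e : R3) (he : ‖e‖ = 1) :
    eLpNorm (fun x => ((inner ℝ x e : ℝ) : ℂ) * multiplier m hm u x) 2 volume ≤
      ENNReal.ofReal (2 * C * D) := by
  set v := multiplier m hm u
  have huD : ‖u‖ ≤ D := (norm_le_norm_toLp_weight_mul zero_le_one hu).trans hD
  have hD0 : 0 ≤ D := (norm_nonneg _).trans hD
  have hmod : ∀ h : R3, ‖mulBounded (character h) (memLp_character h) u - u‖ ≤
      2 * Real.pi * ‖h‖ * D := by
    intro h
    refine le_trans (Lp.norm_le_mul_norm_of_ae_le_mul (g := hu.toLp _)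
      (c := 2 * Real.pi * ‖h‖) ?_) (by gcongr)
    filter_upwards [Lp.coeFn_sub (mulBounded (character h) (memLp_character h) u) u,
      coeFn_mulBounded _ (memLp_character h) u, hu.coeFn_toLp] with x e1 e2 e3
    rw [e1, Pi.sub_apply, e2, e3, ← sub_one_mul, norm_mul, norm_mul, ← mul_assoc, weight_one,
      Complex.norm_real, Real.norm_eq_abs, abs_of_pos (bracket_pos x)]
    gcongr
    exact (norm_character_sub_one_le h x).trans (by gcongr; exact norm_le_bracket x)
  -- The estimate yields (2π + 1)CD; it is weakened to 2π · 2CD so that 2π cancels against the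
  -- constant in the limit.
  have hq : ∀ n : ℕ, eLpNorm (fun x => (((n : ℂ) + 1) *
      (character (((n : ℝ) + 1)⁻¹ • e) x - 1)) * v x) 2 volume ≤
      ENNReal.ofReal (2 * Real.pi * (2 * C * D)) := by
    intro n
    set h : R3 := ((n : ℝ) + 1)⁻¹ • e
    have hn : (0 : ℝ) < (n : ℝ) + 1 := by positivity
    have hh : ‖h‖ = ((n : ℝ) + 1)⁻¹ := by
      rw [norm_smul, he, mul_one, Real.norm_eq_abs, abs_of_pos (inv_pos.2 hn)]
    set w : L2 := ((n : ℂ) + 1) • (mulBounded (character h) (memLp_character h) v - v)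
    have hw : (fun x => (((n : ℂ) + 1) * (character h x - 1)) * v x) =ᵐ[volume] w := by
      filter_upwards [Lp.coeFn_smul ((n : ℂ) + 1)
          (mulBounded (character h) (memLp_character h) v - v),
        Lp.coeFn_sub (mulBounded (character h) (memLp_character h) v) v,
        coeFn_mulBounded _ (memLp_character h) v] with x e1 e2 e3
      rw [e1, Pi.smul_apply, e2, Pi.sub_apply, e3, smul_eq_mul]
      ring
    rw [eLpNorm_congr_ae hw, ← Lp.enorm_def, ← ofReal_norm]
    refine ENNReal.ofReal_le_ofReal ?_
    have hnn : ‖(n : ℂ) + 1‖ = (n : ℝ) + 1 := by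
      rw [← Complex.ofReal_natCast, ← Complex.ofReal_one, ← Complex.ofReal_add, Complex.norm_real,
        Real.norm_eq_abs, abs_of_pos hn]
    rw [norm_smul, hnn]
    have h1 := norm_character_mul_multiplier_sub_le m hm hL h u
    have h2 := hmod h
    rw [hh] at h1 h2
    have h3 : ((n : ℝ) + 1) * ((n : ℝ) + 1)⁻¹ = 1 := mul_inv_cancel₀ hn.ne'
    have hpi := Real.pi_gt_three
    calc ((n : ℝ) + 1) * ‖mulBounded (character h) (memLp_character h) v - v‖
        ≤ ((n : ℝ) + 1) * (C * (2 * Real.pi * ((n : ℝ) + 1)⁻¹ * D) + C * ((n : ℝ) + 1)⁻¹ * D) := by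
          refine mul_le_mul_of_nonneg_left (h1.trans ?_) hn.le
          gcongr
      _ = ((n : ℝ) + 1) * ((n : ℝ) + 1)⁻¹ * ((2 * Real.pi + 1) * (C * D)) := by ring
      _ ≤ 2 * Real.pi * (2 * C * D) := by
          rw [h3]
          nlinarith [mul_nonneg hC hD0]
  have hlim := Lp.eLpNorm_lim_le_liminf_eLpNorm (p := 2) (μ := (volume : Measure R3))
    (f := fun (n : ℕ) x => (((n : ℂ) + 1) * (character (((n : ℝ) + 1)⁻¹ • e) x - 1)) * v x)
    (fun n => ((((continuous_character _).sub continuous_const).const_mul _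
      ).aestronglyMeasurable.mul (Lp.aestronglyMeasurable v)))
    (fun x => ((-(2 * Real.pi * inner ℝ x e) : ℝ) : ℂ) * Complex.I * v x)
    (Filter.Eventually.of_forall fun x =>
      (tendsto_character_difference_quotient e x).mul_const (v x))
  have hlim' := hlim.trans (Filter.liminf_le_of_le (by isBoundedDefault) fun b hb => by
    obtain ⟨n, hn⟩ := hb.exists
    exact hn.trans (hq n))
  have hfun : (fun x => ((-(2 * Real.pi * inner ℝ x e) : ℝ) : ℂ) * Complex.I * v x) =
      (((-(2 * Real.pi) : ℝ) : ℂ) * Complex.I) • fun x => ((inner ℝ x e : ℝ) : ℂ) * v x := by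
    funext x
    simp only [Pi.smul_apply, smul_eq_mul]
    push_cast
    ring
  have hpi : (0 : ℝ) < 2 * Real.pi := by positivity
  have hnorm : ‖(((-(2 * Real.pi) : ℝ) : ℂ) * Complex.I)‖ₑ = ENNReal.ofReal (2 * Real.pi) := by
    rw [← ofReal_norm, norm_mul, Complex.norm_I, mul_one, Complex.norm_real, norm_neg,
      Real.norm_eq_abs, abs_of_pos hpi]
  rw [hfun, eLpNorm_const_smul, hnorm, ENNReal.ofReal_mul hpi.le] at hlim'
  exact (ENNReal.mul_le_mul_iff_right (ENNReal.ofReal_pos.2 hpi).ne' ENNReal.ofReal_ne_top).1 hlim'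

theorem bracket_le_one_add_sum (x : R3) : bracket x ≤ 1 + ∑ i, |x i| := by
  have h : ‖x‖ ≤ ∑ i, |x i| := by
    have := norm_sum_le Finset.univ fun i => x i • EuclideanSpace.single i (1 : ℝ)
    rw [show ∑ i, x i • EuclideanSpace.single i (1 : ℝ) = x from by
      ext j; fin_cases j <;> simp [Fin.sum_univ_three]] at this
    simpa [norm_smul] using this
  nlinarith [bracket_sq x, bracket_pos x, norm_nonneg x]

/-- Multipliers with bounded Lipschitz symbols preserve `L^{2,1}`. -/
theorem eLpNorm_weight_one_mul_multiplier_le {C D : ℝ} (hC : 0 ≤ C) (m : R3 → ℂ)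
    (hm : MemLp (rescale m) ∞ (volume : Measure R3))
    (hL : BoundedLipschitzOn C Set.univ (rescale m)) (u : L2)
    (hu : MemLp (fun x => weight 1 x * u x) 2 volume) (hD : ‖hu.toLp _‖ ≤ D) :
    eLpNorm (fun x => weight 1 x * multiplier m hm u x) 2 volume ≤
      ENNReal.ofReal (7 * C * D) := by
  set v := multiplier m hm u
  have hD0 : 0 ≤ D := (norm_nonneg _).trans hD
  have huD : ‖u‖ ≤ D := (norm_le_norm_toLp_weight_mul zero_le_one hu).trans hD
  have hv : AEStronglyMeasurable v volume := Lp.aestronglyMeasurable v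
  let F : Fin 3 → R3 → ℝ := fun i x =>
    ‖((inner ℝ x (EuclideanSpace.single i (1 : ℝ)) : ℝ) : ℂ) * v x‖
  have hFm : ∀ i, AEStronglyMeasurable (F i) volume := fun i =>
    ((Continuous.aestronglyMeasurable (by fun_prop)).mul hv).norm
  have hF : ∀ i, eLpNorm (F i) 2 volume ≤ ENNReal.ofReal (2 * C * D) := fun i => by
    rw [eLpNorm_norm]
    exact eLpNorm_inner_mul_multiplier_le hC m hm hL u hu hD _ (by simp)
  have hv0 : eLpNorm (fun x => ‖v x‖) 2 volume ≤ ENNReal.ofReal (C * D) := by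
    rw [eLpNorm_norm, ← Lp.enorm_def, ← ofReal_norm]
    refine ENNReal.ofReal_le_ofReal
      ((norm_multiplier_le m hm (fun ξ => hL.1 ξ trivial) u).trans (by gcongr))
  calc eLpNorm (fun x => weight 1 x * v x) 2 volume
      ≤ eLpNorm ((fun x => ‖v x‖) + ∑ i, F i) 2 volume := by
        refine eLpNorm_mono_real fun x => ?_
        rw [norm_mul, weight_one, Complex.norm_real, Real.norm_eq_abs, abs_of_pos (bracket_pos x)]
        refine (mul_le_mul_of_nonneg_right (bracket_le_one_add_sum x) (norm_nonneg _)).trans ?_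
        simp [F, Finset.sum_mul, add_mul, EuclideanSpace.inner_single_right]
    _ ≤ eLpNorm (fun x => ‖v x‖) 2 volume + eLpNorm (∑ i, F i) 2 volume :=
        eLpNorm_add_le hv.norm (Finset.aestronglyMeasurable_sum _ fun i _ => hFm i) one_le_two
    _ ≤ ENNReal.ofReal (C * D) + ∑ _i : Fin 3, ENNReal.ofReal (2 * C * D) := by
        refine add_le_add hv0 ((eLpNorm_sum_le (fun i _ => hFm i) one_le_two).trans ?_)
        exact Finset.sum_le_sum fun i _ => hF i
    -- 7 = 1 + 3 · 2: the function itself and the three coordinates.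
    _ = ENNReal.ofReal (7 * C * D) := by
        rw [← ENNReal.ofReal_sum_of_nonneg fun i _ => by positivity,
          ← ENNReal.ofReal_add (by positivity) (by positivity)]
        congr 1
        simp
        ring


/-! ### Multipliers as operators on tempered distributions -/

theorem smulLeftCLM_ofL2 {g : R3 → ℂ} (hg : g.HasTemperateGrowth) {u v : L2}
    (h : v =ᵐ[volume] fun x => g x * u x) :
    TemperedDistribution.smulLeftCLM ℂ g (ofL2 u) = ofL2 v := by
  ext φ
  change Lp.toTemperedDistribution u (SchwartzMap.smulLeftCLM ℂ g φ) =
    Lp.toTemperedDistribution v φ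
  rw [Lp.toTemperedDistribution_apply, Lp.toTemperedDistribution_apply]
  refine integral_congr_ae ?_
  filter_upwards [h] with x hx
  rw [hx, SchwartzMap.smulLeftCLM_apply_apply hg]
  simp only [smul_eq_mul]
  ring

theorem eq_multiplier_of_fourier {m : R3 → ℂ} (hm : MemLp (rescale m) ∞ (volume : Measure R3))
    {u v : L2} (h : (𝓕 v : L2) =ᵐ[volume] fun ξ => rescale m ξ * (𝓕 u : L2) ξ) :
    v = multiplier m hm u := by
  refine (Lp.fourierTransformₗᵢ R3 ℂ).injective (Lp.ext ?_)
  exact h.trans (fourier_multiplier m hm u).symm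

theorem multiplier_sub {m m' : R3 → ℂ} (hm : MemLp (rescale m) ∞ (volume : Measure R3))
    (hm' : MemLp (rescale m') ∞ (volume : Measure R3)) (u : L2) :
    multiplier m hm u - multiplier m' hm' u =
      multiplier (fun ξ => m ξ - m' ξ) (hm.sub hm') u := by
  refine eq_multiplier_of_fourier _ ?_
  rw [fourier_L2_sub]
  filter_upwards [fourier_multiplier m hm u, fourier_multiplier m' hm' u,
    Lp.coeFn_sub (𝓕 (multiplier m hm u) : L2) (𝓕 (multiplier m' hm' u))] with ξ h1 h2 h3
  rw [h3, Pi.sub_apply, h1, h2]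
  simp only [rescale]
  ring

/-- Symbols multiply on the Fourier side; boundedness of the product symbol keeps the result in L².
-/
theorem bracketD_ofL2_multiplier {l : ℝ} {m : R3 → ℂ}
    (hm : MemLp (rescale m) ∞ (volume : Measure R3))
    (hlm : MemLp (rescale fun ξ => weight l ξ * m ξ) ∞ (volume : Measure R3)) (u : L2) :
    bracketD l (ofL2 (multiplier m hm u)) =
      ofL2 (multiplier (fun ξ => weight l ξ * m ξ) hlm u) := by
  unfold bracketD
  rw [TemperedDistribution.fourierMultiplierCLM_apply]
  have h1 : 𝓕 (ofL2 (multiplier m hm u)) = ofL2 (𝓕 (multiplier m hm u)) :=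
    Lp.fourier_toTemperedDistribution_eq _
  have h2 : TemperedDistribution.smulLeftCLM ℂ (rescale (weight l))
      (ofL2 (𝓕 (multiplier m hm u))) =
      ofL2 (𝓕 (multiplier (fun ξ => weight l ξ * m ξ) hlm u)) := by
    refine smulLeftCLM_ofL2 (rescale_weight_hasTemperateGrowth l) ?_
    filter_upwards [fourier_multiplier m hm u, fourier_multiplier _ hlm u] with ξ e1 e2
    rw [e1, e2]
    simp only [rescale]
    ring
  have h3 : ∀ v : L2, 𝓕⁻ (ofL2 v) = ofL2 (𝓕⁻ v) := Lp.fourierInv_toTemperedDistribution_eq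
  rw [h1, h2, h3, FourierTransform.fourierInv_fourier_eq]

/-! ### Comparison of weights and the weighted estimate -/

theorem norm_weight_le_of_le {r s : ℝ} (h : r ≤ s) (x : R3) : ‖weight r x‖ ≤ ‖weight s x‖ := by
  have hpos : ∀ p : ℝ, ‖weight p x‖ = bracket x ^ p := fun p => by
    rw [weight, Complex.norm_real, Real.norm_eq_abs,
      abs_of_pos (Real.rpow_pos_of_pos (bracket_pos x) p)]
  rw [hpos, hpos]
  exact Real.rpow_le_rpow_of_exponent_le (one_le_bracket x) h

theorem continuous_weight (s : ℝ) : Continuous (weight s) :=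
  (weight_hasTemperateGrowth s).1.continuous

namespace WeightedL2

variable {s : ℝ}

theorem coeFn_toL2 (hs : 0 ≤ s) (f : WeightedL2 s) : f.toL2 hs =ᵐ[volume] toFun f :=
  MemLp.coeFn_toLp _

theorem toL2_add (hs : 0 ≤ s) (f g : WeightedL2 s) : (f + g).toL2 hs = f.toL2 hs + g.toL2 hs := by
  refine Lp.ext ?_
  filter_upwards [coeFn_toL2 hs f, coeFn_toL2 hs g, coeFn_toL2 hs (f + g),
    Lp.coeFn_add (f.toL2 hs) (g.toL2 hs), AEEqFun.coeFn_add (toFun f) (toFun g)]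
    with x h1 h2 h3 h4 h5
  rw [h3, h4, Pi.add_apply, h1, h2, map_add, h5, Pi.add_apply]

theorem toL2_smul (hs : 0 ≤ s) (c : ℂ) (f : WeightedL2 s) : (c • f).toL2 hs = c • f.toL2 hs := by
  refine Lp.ext ?_
  filter_upwards [coeFn_toL2 hs f, coeFn_toL2 hs (c • f), Lp.coeFn_smul c (f.toL2 hs),
    AEEqFun.coeFn_smul c (toFun f)] with x h1 h2 h3 h4
  rw [h2, h3, Pi.smul_apply, h1, map_smul, h4, Pi.smul_apply]

theorem memLp_weight_mul_toL2 (hs : 0 ≤ s) {r : ℝ} (hr : r ≤ s) (f : WeightedL2 s) :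
    MemLp (fun x => weight r x * f.toL2 hs x) 2 volume := by
  refine (memLp f).mono ((continuous_weight r).aestronglyMeasurable.mul
    (Lp.aestronglyMeasurable _)) ?_
  filter_upwards [coeFn_toL2 hs f] with x hx
  rw [hx, norm_mul, norm_mul]
  gcongr
  exact norm_weight_le_of_le hr x

theorem norm_toLp_weight_mul_toL2_le (hs : 0 ≤ s) {r : ℝ} (hr : r ≤ s) (f : WeightedL2 s) :
    ‖(memLp_weight_mul_toL2 hs hr f).toLp _‖ ≤ ‖f‖ := by
  rw [norm_def]
  refine Lp.norm_le_norm_of_ae_le ?_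
  filter_upwards [coeFn_toL2 hs f, (memLp_weight_mul_toL2 hs hr f).coeFn_toLp,
    (memLp f).coeFn_toLp] with x h1 h2 h3
  rw [h2, mulWeight, LinearMap.coe_mk, AddHom.coe_mk, h3, h1, norm_mul, norm_mul]
  gcongr
  exact norm_weight_le_of_le hr x

theorem norm_toL2_le (hs : 0 ≤ s) (f : WeightedL2 s) : ‖f.toL2 hs‖ ≤ ‖f‖ :=
  (norm_le_norm_toLp_weight_mul hs (memLp_weight_mul_toL2 hs le_rfl f)).trans
    (norm_toLp_weight_mul_toL2_le hs le_rfl f)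

end WeightedL2

/-- For `t ≤ 0` the weight is at most 1 and the L² bound is enough; otherwise both weights are
compared with ⟨x⟩ and the L^{2,1} bound applies. -/
theorem eLpNorm_weight_mul_multiplier_le {s t C : ℝ} (hs : 0 ≤ s)
    (ht : t ≤ 0 ∨ t ≤ 1 ∧ 1 ≤ s) (hC : 0 ≤ C) (m : R3 → ℂ)
    (hm : MemLp (rescale m) ∞ (volume : Measure R3))
    (hL : BoundedLipschitzOn C Set.univ (rescale m)) (f : WeightedL2 s) :
    eLpNorm (fun x => weight t x * multiplier m hm (f.toL2 hs) x) 2 volume ≤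
      ENNReal.ofReal (7 * C * ‖f‖) := by
  rcases ht with ht | ⟨ht, hs1⟩
  · calc eLpNorm (fun x => weight t x * multiplier m hm (f.toL2 hs) x) 2 volume
        ≤ eLpNorm (multiplier m hm (f.toL2 hs)) 2 volume := by
          refine eLpNorm_mono fun x => ?_
          rw [norm_mul]
          refine mul_le_of_le_one_left (norm_nonneg _) ((norm_weight_le_of_le ht x).trans ?_)
          simp [weight]
      _ = ENNReal.ofReal ‖multiplier m hm (f.toL2 hs)‖ := by rw [ofReal_norm, Lp.enorm_def]
      _ ≤ ENNReal.ofReal (7 * C * ‖f‖) := by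
          refine ENNReal.ofReal_le_ofReal
            ((norm_multiplier_le m hm (fun ξ => hL.1 ξ trivial) _).trans ?_)
          gcongr
          · linarith
          · exact f.norm_toL2_le hs
  · refine le_trans (eLpNorm_mono fun x => ?_) (eLpNorm_weight_one_mul_multiplier_le hC m hm hL
      (f.toL2 hs) (f.memLp_weight_mul_toL2 hs hs1) (f.norm_toLp_weight_mul_toL2_le hs hs1))
    rw [norm_mul, norm_mul]
    gcongr
    exact norm_weight_le_of_le ht x

/-- 49 = 7 · 7: one factor from the 2π dilation of the symbol, one from the L^{2,1} estimate. -/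
theorem exists_weightBracketD_multiplier_eq {s t C : ℝ} (hs : 0 ≤ s)
    (ht : t ≤ 0 ∨ t ≤ 1 ∧ 1 ≤ s) (hC : 0 ≤ C) {m : R3 → ℂ}
    (hm : MemLp (rescale m) ∞ (volume : Measure R3))
    (hL : BoundedLipschitzOn C Set.univ fun ξ => weight 1 ξ * m ξ) (f : WeightedL2 s) :
    ∃ v : L2, ofL2 v = weightBracketD 1 t (ofL2 (multiplier m hm (f.toL2 hs))) ∧
      ‖v‖ ≤ 49 * C * ‖f‖ := by
  have hL' := hL.rescale hC
  have hle := eLpNorm_weight_mul_multiplier_le hs ht (by positivity) _ hL'.memLp_top hL' f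
  have hmem : MemLp (fun x => weight t x *
      multiplier (fun ξ => weight 1 ξ * m ξ) hL'.memLp_top (f.toL2 hs) x) 2 volume :=
    ⟨(continuous_weight t).aestronglyMeasurable.mul (Lp.aestronglyMeasurable _),
      hle.trans_lt ENNReal.ofReal_lt_top⟩
  refine ⟨hmem.toLp _, ?_, ?_⟩
  · rw [weightBracketD, ContinuousLinearMap.comp_apply,
      bracketD_ofL2_multiplier hm hL'.memLp_top]
    exact (smulLeftCLM_ofL2 (weight_hasTemperateGrowth t) hmem.coeFn_toLp).symm
  · rw [Lp.norm_toLp]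
    refine (ENNReal.toReal_mono ENNReal.ofReal_ne_top hle).trans_eq ?_
    rw [ENNReal.toReal_ofReal (by positivity)]
    ring

namespace WeightedSobolev

variable {l t : ℝ}

/-- The element of `H^{ℓ,t}` given by a tempered distribution. -/
def ofDistribution (F : 𝓢'(R3, ℂ)) (hF : weightBracketD l t F ∈ LinearMap.range ofL2) :
    WeightedSobolev l t :=
  (⟨F, hF⟩ : ↥(weightedSobolevSubmodule l t))

theorem toDistribution_ofDistribution (F : 𝓢'(R3, ℂ))
    (hF : weightBracketD l t F ∈ LinearMap.range ofL2) :
    toDistribution (ofDistribution F hF) = F := rfl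

theorem toDistribution_injective : Function.Injective (toDistribution (l := l) (t := t)) :=
  Subtype.val_injective

theorem norm_eq_of_ofL2_eq {f : WeightedSobolev l t} {v : L2}
    (h : ofL2 v = weightBracketD l t (toDistribution f)) : ‖f‖ = ‖v‖ := by
  rw [norm_def, ofL2_injective ((ofL2_mulWeight f).trans h.symm)]

end WeightedSobolev

/-! ### The operators between the weighted spaces -/

/-- The operator `m(D)` from `L^{2,s}` to `H^{1,t}`, as a linear map. -/
def weightedMultiplierₗ {s t C : ℝ} (hs : 0 ≤ s) (ht : t ≤ 0 ∨ t ≤ 1 ∧ 1 ≤ s) (hC : 0 ≤ C)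
    {m : R3 → ℂ} (hm : MemLp (rescale m) ∞ (volume : Measure R3))
    (hL : BoundedLipschitzOn C Set.univ fun ξ => weight 1 ξ * m ξ) :
    WeightedL2 s →ₗ[ℂ] WeightedSobolev 1 t where
  toFun f := WeightedSobolev.ofDistribution (ofL2 (multiplier m hm (f.toL2 hs)))
    (LinearMap.mem_range.2
      ((exists_weightBracketD_multiplier_eq hs ht hC hm hL f).imp fun _ h => h.1))
  map_add' f g := by
    refine WeightedSobolev.toDistribution_injective ?_
    rw [map_add WeightedSobolev.toDistribution, WeightedSobolev.toDistribution_ofDistribution,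
      WeightedSobolev.toDistribution_ofDistribution, WeightedSobolev.toDistribution_ofDistribution,
      WeightedL2.toL2_add, map_add (multiplier m hm), map_add ofL2]
  map_smul' c f := by
    refine WeightedSobolev.toDistribution_injective ?_
    rw [map_smul WeightedSobolev.toDistribution, WeightedSobolev.toDistribution_ofDistribution,
      WeightedSobolev.toDistribution_ofDistribution, WeightedL2.toL2_smul,
      map_smul (multiplier m hm), map_smul ofL2, RingHom.id_apply]

theorem toDistribution_weightedMultiplierₗ {s t C : ℝ} (hs : 0 ≤ s) (ht : t ≤ 0 ∨ t ≤ 1 ∧ 1 ≤ s)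
    (hC : 0 ≤ C) {m : R3 → ℂ} (hm : MemLp (rescale m) ∞ (volume : Measure R3))
    (hL : BoundedLipschitzOn C Set.univ fun ξ => weight 1 ξ * m ξ) (f : WeightedL2 s) :
    (weightedMultiplierₗ hs ht hC hm hL f).toDistribution = ofL2 (multiplier m hm (f.toL2 hs)) :=
  rfl

theorem norm_weightedMultiplierₗ_le {s t C : ℝ} (hs : 0 ≤ s) (ht : t ≤ 0 ∨ t ≤ 1 ∧ 1 ≤ s)
    (hC : 0 ≤ C) {m : R3 → ℂ} (hm : MemLp (rescale m) ∞ (volume : Measure R3))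
    (hL : BoundedLipschitzOn C Set.univ fun ξ => weight 1 ξ * m ξ) (f : WeightedL2 s) :
    ‖weightedMultiplierₗ hs ht hC hm hL f‖ ≤ 49 * C * ‖f‖ := by
  obtain ⟨v, hv, hle⟩ := exists_weightBracketD_multiplier_eq hs ht hC hm hL f
  rw [← toDistribution_weightedMultiplierₗ hs ht hC hm hL] at hv
  rwa [WeightedSobolev.norm_eq_of_ofL2_eq hv]

/-- The operator `m(D)` from `L^{2,s}` to `H^{1,t}`, for a symbol `m` such that `⟨ξ⟩ m(ξ)` is
bounded and Lipschitz. -/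
def weightedMultiplier {s t C : ℝ} (hs : 0 ≤ s) (ht : t ≤ 0 ∨ t ≤ 1 ∧ 1 ≤ s) (hC : 0 ≤ C)
    {m : R3 → ℂ} (hm : MemLp (rescale m) ∞ (volume : Measure R3))
    (hL : BoundedLipschitzOn C Set.univ fun ξ => weight 1 ξ * m ξ) :
    WeightedL2 s →L[ℂ] WeightedSobolev 1 t :=
  (weightedMultiplierₗ hs ht hC hm hL).mkContinuous (49 * C)
    (norm_weightedMultiplierₗ_le hs ht hC hm hL)

theorem toDistribution_weightedMultiplier {s t C : ℝ} (hs : 0 ≤ s) (ht : t ≤ 0 ∨ t ≤ 1 ∧ 1 ≤ s)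
    (hC : 0 ≤ C) {m : R3 → ℂ} (hm : MemLp (rescale m) ∞ (volume : Measure R3))
    (hL : BoundedLipschitzOn C Set.univ fun ξ => weight 1 ξ * m ξ) (f : WeightedL2 s) :
    (weightedMultiplier hs ht hC hm hL f).toDistribution = ofL2 (multiplier m hm (f.toL2 hs)) :=
  rfl

/-- The difference is again a multiplier, so its norm is governed by the constant `K` of the
difference symbol, however large `C` and `C'` are. -/
theorem norm_weightedMultiplier_sub_le {s t C C' K : ℝ} (hs : 0 ≤ s)
    (ht : t ≤ 0 ∨ t ≤ 1 ∧ 1 ≤ s) (hC : 0 ≤ C) (hC' : 0 ≤ C') (hK : 0 ≤ K) {m m' : R3 → ℂ}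
    (hm : MemLp (rescale m) ∞ (volume : Measure R3))
    (hm' : MemLp (rescale m') ∞ (volume : Measure R3))
    (hL : BoundedLipschitzOn C Set.univ fun ξ => weight 1 ξ * m ξ)
    (hL' : BoundedLipschitzOn C' Set.univ fun ξ => weight 1 ξ * m' ξ)
    (hd : BoundedLipschitzOn K Set.univ fun ξ => weight 1 ξ * (m ξ - m' ξ)) :
    ‖(weightedMultiplier hs ht hC hm hL : WeightedL2 s →L[ℂ] WeightedSobolev 1 t) -
      weightedMultiplier hs ht hC' hm' hL'‖ ≤ 49 * K := by
  refine ContinuousLinearMap.opNorm_le_bound _ (by positivity) fun f => ?_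
  obtain ⟨v, hv, hle⟩ := exists_weightBracketD_multiplier_eq hs ht hK
    (m := fun ξ => m ξ - m' ξ) (hm.sub hm') hd f
  refine (WeightedSobolev.norm_eq_of_ofL2_eq (hv.trans ?_)).trans_le hle
  rw [_root_.sub_apply, map_sub, toDistribution_weightedMultiplier,
    toDistribution_weightedMultiplier, ← map_sub, multiplier_sub]

end SqrtLaplacian

end
-- Boundedness and continuity of B(z)
theorem theorem3p3 {a b : ℝ} (ha : 0 < a) (hab : a < b)
    {γ : SqrtLaplacian.R3 → ℂ} (hγ : SqrtLaplacian.IsCutoff a b γ)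
    {s t : ℝ} (hs : 0 ≤ s) (hs' : s < 5 / 2) (ht : t < s - 3 / 2) :
    ∃ T : SqrtLaplacian.rectD a b →
        (SqrtLaplacian.WeightedL2 s →L[ℂ] SqrtLaplacian.WeightedSobolev 1 t),
      (∀ (z : SqrtLaplacian.rectD a b) (u : SqrtLaplacian.WeightedL2 s),
        (T z u).toDistribution =
          SqrtLaplacian.ofL2 (SqrtLaplacian.opB ha hab hγ z (u.toL2 hs))) ∧
      Continuous T := by
  obtain ⟨C, hC, hL, hd⟩ :=
    SqrtLaplacian.exists_boundedLipschitzOn_weight_mul_symbolB ha hab hγ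
  -- If `t > 0` then s > 3/2, and t < 5/2 - 3/2 = 1 in any case.
  have ht' : t ≤ 0 ∨ t ≤ 1 ∧ 1 ≤ s := by
    rcases le_or_gt t 0 with h | h
    · exact Or.inl h
    · exact Or.inr ⟨by linarith, by linarith⟩
  refine ⟨fun z => SqrtLaplacian.weightedMultiplier hs ht' hC
    (SqrtLaplacian.symbolB_memLp ha hab hγ z.2) (hL z z.2), fun z u => rfl, ?_⟩
  refine continuous_iff_continuousAt.2 fun w => ?_
  refine tendsto_iff_norm_sub_tendsto_zero.2 ?_
  -- As `C` does not depend on z, the norm of the difference is at most 49 C |z² - w²|, which tends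
  -- to 0.
  refine squeeze_zero (fun _ => norm_nonneg _) (fun z =>
    SqrtLaplacian.norm_weightedMultiplier_sub_le hs ht' hC hC (by positivity) _ _ _ _
      (hd z z.2 w w.2)) ?_
  have hcont : Continuous fun z : SqrtLaplacian.rectD a b =>
      49 * (C * ‖(z : ℂ) ^ 2 - (w : ℂ) ^ 2‖) := by fun_prop
  simpa using hcont.tendsto w
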